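/- Let $K$ be a field of characteristic zero. For a homogeneous ideal $I\neq 0$ of a polynomial ring $R=L[x_0,\dots,x_3]$ over a field $L$, let $\alpha(I)$ be the least degree of a nonzero form in $I$, and let $I^{(k)}=R\cap\bigcap_{\mathfrak p\in \mathrm{Ass}(R/I)} I^kR_{\mathfrak p}$ be its $k$-th symbolic power. For points $p_1,\dots,p_r\in\mathbb P^3$ and integers $m_1,\dots,m_r$ let $I(p;m_1,\dots,m_r)=\bigcap_{j}\mathfrak m_{p_j}^{m_j}$, where $\mathfrak m_p$ is the ideal generated by the forms vanishing at $p$ and $\mathfrak m_p^{m}$ is the whole ring for $m<0$. For each sequence of integers $(m_1,\dots,m_r)$ write $\alpha(I(m_1,\dots,m_r)^{(k)})$ for the value of $\alpha(I(p;m_1,\dots,m_r)^{(k)})$ for points $p_1,\dots,p_r$ in general position, that is, for all $(p_1,\dots,p_r)$ in some nonempty Zariski open subset of $(\mathbb P^3)^r$ that is defined over $K$ and may depend on $k$; the points may be rational over $K$ or over any extension field $L$ of $K$. Put $$\gamma(I(m_1,\dots,m_r))=\lim_{k\to\infty}\frac{\alpha(I(m_1,\dots,m_r)^{(k)})}{k}.$$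 Theorem. Let $n\ge 0$ and let $\mathbf m=(m_1,\dots,m_n)$ be any sequence of integers. Then the Waldschmidt constants $\gamma(I(1^{\times 8},\mathbf m))$ and $\gamma(I(2,\mathbf m))$ in $\mathbb P^3$ are well defined (the general values of $\alpha$ and the limits exist), and $$\gamma(I(1^{\times 8},\mathbf m))\ \ge\ \gamma(I(2,\mathbf m)),$$ where $1^{\times 8}$ denotes the sequence of eight ones. -/

import Mathlib

open scoped LinearAlgebra.Projectivization

universe u

namespace FatPoints

noncomputable section

/-- The `m`-th symbolic power `I^{(m)} = R ∩ ⋂_{P ∈ Ass(I)} I^m R_P`. -/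
def symbolicPower {R : Type u} [CommRing R] (I : Ideal R) (m : ℕ) : Ideal R :=
  ⨅ P : associatedPrimes R (R ⧸ I),
    haveI : (P : Ideal R).IsPrime := P.2.1
    ((I ^ m).map (algebraMap R (Localization.AtPrime (P : Ideal R)))).comap
      (algebraMap R (Localization.AtPrime (P : Ideal R)))

/-- The least degree of a nonzero form in `I` (meaningful when `I` is homogeneous and nonzero). -/
def alpha {L : Type u} [Field L] {N : ℕ} (I : Ideal (MvPolynomial (Fin (N + 1)) L)) : ℕ :=
  sInf {t : ℕ | ∃ f ∈ I, f ≠ 0 ∧ f.IsHomogeneous t}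

/-- `γ` is the Waldschmidt constant `lim α(I^{(k)}) / k` of `I`. -/
def HasWaldschmidtConstant {L : Type u} [Field L] {N : ℕ}
    (I : Ideal (MvPolynomial (Fin (N + 1)) L)) (γ : ℝ) : Prop :=
  Filter.Tendsto (fun k : ℕ => (alpha (symbolicPower I k) : ℝ) / k) Filter.atTop (nhds γ)

/-- The ideal `𝔪_p` generated by the forms vanishing at `p ∈ ℙ^N(L)`. -/
def pointIdeal {L : Type u} [Field L] {N : ℕ} (p : ℙ L (Fin (N + 1) → L)) :
    Ideal (MvPolynomial (Fin (N + 1)) L) :=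
  Ideal.span {f | (∃ d, f.IsHomogeneous d) ∧ MvPolynomial.eval p.rep f = 0}

/-- The ideal `⋂ j, 𝔪_{p_j}^{m_j}`, where `𝔪_p^m` is the whole ring for `m < 0`. -/
def fatPointsIdeal {L : Type u} [Field L] {N n : ℕ} (p : Fin n → ℙ L (Fin (N + 1) → L))
    (m : Fin n → ℤ) : Ideal (MvPolynomial (Fin (N + 1)) L) :=
  ⨅ j, pointIdeal (p j) ^ (m j).toNat

/-- `P` holds for `n` points of `ℙ^N` in general position: there is a nonzero polynomial `F` over
`K` in the coordinates of `n` vectors such that `P` holds for every `n`-tuple of points (rational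
over `K` or over any extension field `L` of `K`) that has homogeneous coordinates `v` with
`F(v) ≠ 0`. The tuples having such coordinates form a nonempty Zariski open subset of `(ℙ^N)^n`,
and all subsets `{F ≠ 0}` with `F` multihomogeneous are of this kind. -/
def ForGeneralPoints (K : Type u) [Field K] (N n : ℕ)
    (P : ∀ (L : Type u) [Field L] [Algebra K L], (Fin n → ℙ L (Fin (N + 1) → L)) → Prop) : Prop :=
  ∃ F : MvPolynomial (Fin n × Fin (N + 1)) K, F ≠ 0 ∧
    ∀ (L : Type u) [Field L] [Algebra K L] (v : Fin n → Fin (N + 1) → L) (hv : ∀ j, v j ≠ 0),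
      MvPolynomial.aeval (fun i : Fin n × Fin (N + 1) => v i.1 i.2) F ≠ 0 →
        P L (fun j => Projectivization.mk L (v j) (hv j))

/-- `γ = γ(I(m))` for the ideal `I(m)` of points of `ℙ^N` in general position with multiplicities
`m`. For each `k ≥ 1` the number `α(I(m)^{(k)})` is the value taken for points in general position
(the open set may depend on `k`), and `γ` is the limit of `α(I(m)^{(k)}) / k`. -/
def IsGenericWaldschmidtConstant (K : Type u) [Field K] (N : ℕ) {n : ℕ} (m : Fin n → ℤ)
    (γ : ℝ) : Prop :=
  ∃ a : ℕ → ℕ,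
    (∀ k : ℕ, 1 ≤ k → ForGeneralPoints K N n
      (fun _ _ _ p => alpha (symbolicPower (fatPointsIdeal p m) k) = a k)) ∧
    Filter.Tendsto (fun k : ℕ => (a k : ℝ) / k) Filter.atTop (nhds γ)

/-- If the coordinates of the points are algebraically independent over `K`, then the constant is
the Waldschmidt constant of the actual ideal of these points. -/
theorem IsGenericWaldschmidtConstant.hasWaldschmidtConstant {K : Type u} [Field K] {N n : ℕ}
    {m : Fin n → ℤ} {γ : ℝ} (h : IsGenericWaldschmidtConstant K N m γ)
    {L : Type u} [Field L] [Algebra K L] (v : Fin n → Fin (N + 1) → L) (hv : ∀ j, v j ≠ 0)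
    (hgen : AlgebraicIndependent K (fun i : Fin n × Fin (N + 1) => v i.1 i.2)) :
    HasWaldschmidtConstant
      (fatPointsIdeal (fun j => Projectivization.mk L (v j) (hv j)) m) γ := by
  obtain ⟨a, ha, hlim⟩ := h
  refine hlim.congr' ?_
  filter_upwards [Filter.eventually_ge_atTop 1] with k hk
  obtain ⟨F, hF, hP⟩ := ha k hk
  have hne : MvPolynomial.aeval (fun i : Fin n × Fin (N + 1) => v i.1 i.2) F ≠ 0 :=
    fun h0 => hF (hgen.eq_zero_of_aeval_eq_zero F h0)
  rw [hP L v hv hne]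

/-- The constant is unique. -/
theorem IsGenericWaldschmidtConstant.unique {K : Type u} [Field K] {N n : ℕ}
    {m : Fin n → ℤ} {γ γ' : ℝ} (h : IsGenericWaldschmidtConstant K N m γ)
    (h' : IsGenericWaldschmidtConstant K N m γ') : γ = γ' := by
  have hX := (MvPolynomial.algebraicIndependent_X (Fin n × Fin (N + 1)) K).map'
    (f := IsScalarTower.toAlgHom K (MvPolynomial (Fin n × Fin (N + 1)) K)
      (FractionRing (MvPolynomial (Fin n × Fin (N + 1)) K)))
    (IsFractionRing.injective _ _)
  let v : Fin n → Fin (N + 1) → FractionRing (MvPolynomial (Fin n × Fin (N + 1)) K) :=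
    fun i j => algebraMap (MvPolynomial (Fin n × Fin (N + 1)) K) _ (MvPolynomial.X (i, j))
  have hv : ∀ j, v j ≠ 0 := fun j h0 => by
    have := hX.ne_zero (j, 0)
    exact this (congrFun h0 0)
  exact tendsto_nhds_unique (h.hasWaldschmidtConstant v hv hX)
    (h'.hasWaldschmidtConstant v hv hX)

end

end FatPoints

/-! Let `2 ^ N` of the points (eight for `N = 3`) collide at `u` along the vertices `u + t b` of a
shrinking cube. Take a family `φ_t` of degree at most `d` with multiplicity at least `k` at these
vertices, divided by a power of `t` so that `φ_0 ≠ 0`. Write `φ_t(u + tX) = t^e χ_t(X)` with `χ_0 ≠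
0`. Then `χ_0` has degree at most `e` and multiplicity at least `k` at every vertex of the unit
cube, which forces `2k ≤ e` (`two_mul_le_of_multiplicity_cube`). A coefficient of `φ_t(u + X)` in
degree `s < e` is divisible by `t^(e-s)`, so `φ_0` has multiplicity at least `2k` at `u`
(`HasInterpolant.collision`). The conditions at the other points survive the limit. This compares
the generic least degrees for every `k`, hence the limits.

The rest identifies these degrees with the values of `alpha`. At distinct points, symbolic powers
multiply the exponents (`symbolicPower_iInf_pow`), and forms become affine polynomials of bounded
degree (`alpha_iInf_pow`). The least degree is constant on an open set: interpolants at generic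
points specialise to all points (`HasInterpolant.of_generic`), and their absence is an open
condition (`exists_forall_not_hasInterpolant`). Products of interpolants make the least degree
subadditive in `k`, so the limits exist by Fekete's lemma. -/

namespace FatPoints

noncomputable section

open MvPolynomial

/-! ### Translations, and multiplicity as membership in powers of `idealOfVars` -/

section Translate

variable {σ A B : Type*} [CommRing A] [CommRing B]

/-- The polynomial `φ(X + y)`. -/
def translate (y : σ → A) : MvPolynomial σ A →ₐ[A] MvPolynomial σ A :=
  aeval fun i => X i + C (y i)

@[simp]
theorem translate_X (y : σ → A) (i : σ) : translate y (X i) = X i + C (y i) := by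
  simp [translate]

theorem map_translate (g : A →+* B) (y : σ → A) (φ : MvPolynomial σ A) :
    map g (translate y φ) = translate (fun i => g (y i)) (map g φ) := by
  induction φ using MvPolynomial.induction_on with
  | C a => simp [translate]
  | add p q hp hq => simp only [map_add, hp, hq]
  | mul_X p i hp => simp only [map_mul, hp, translate_X, map_add, map_X, map_C]

theorem translate_injective (y : σ → A) : Function.Injective (translate y) := by
  have h : (translate fun i => -y i).comp (translate y) = AlgHom.id A _ := by
    ext i : 1
    simp
  intro p q hpq
  have := congrArg (translate fun i => -y i) hpq
  rw [← AlgHom.comp_apply, ← AlgHom.comp_apply, h] at this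
  simpa using this

theorem map_mem_pow_idealOfVars (g : A →+* B) {n : ℕ} {φ : MvPolynomial σ A}
    (h : φ ∈ idealOfVars σ A ^ n) : map g φ ∈ idealOfVars σ B ^ n := by
  rw [mem_pow_idealOfVars_iff'] at h ⊢
  intro s hs
  rw [coeff_map, h s hs, map_zero]

theorem mem_pow_idealOfVars_of_C_mul [IsDomain A] {n : ℕ} {c : A} (hc : c ≠ 0)
    {φ : MvPolynomial σ A} (h : C c * φ ∈ idealOfVars σ A ^ n) : φ ∈ idealOfVars σ A ^ n := by
  rw [mem_pow_idealOfVars_iff'] at h ⊢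
  intro s hs
  have := h s hs
  rw [coeff_C_mul] at this
  exact (mul_eq_zero.mp this).resolve_left hc

theorem map_mem_pow_idealOfVars_of_X {τ : Type*} {g : MvPolynomial σ A →+* MvPolynomial τ B}
    (hg : ∀ i, g (X i) ∈ idealOfVars τ B) {n : ℕ} {φ : MvPolynomial σ A}
    (h : φ ∈ idealOfVars σ A ^ n) : g φ ∈ idealOfVars τ B ^ n := by
  have h1 : (idealOfVars σ A).map g ≤ idealOfVars τ B := by
    rw [Ideal.map_span, Ideal.span_le]
    rintro _ ⟨_, ⟨i, rfl⟩, rfl⟩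
    exact hg i
  have h2 := Ideal.mem_map_of_mem g h
  rw [Ideal.map_pow] at h2
  exact Ideal.pow_right_mono h1 n h2

theorem mem_pow_idealOfVars_iff_le_order {n : ℕ} {φ : MvPolynomial σ A} :
    φ ∈ idealOfVars σ A ^ n ↔ (n : ℕ∞) ≤ (φ : MvPowerSeries σ A).order := by
  rw [mem_pow_idealOfVars_iff']
  constructor
  · intro h
    exact MvPowerSeries.nat_le_order fun s hs => by simpa using h s hs
  · intro h s hs
    rw [← coeff_coe]
    exact MvPowerSeries.coeff_of_lt_order (lt_of_lt_of_le (by exact_mod_cast hs) h)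

/-- The order of power series over a domain is additive. This is the source of the primary property
of powers of point ideals. -/
theorem mem_pow_idealOfVars_of_mul_left [IsDomain A] {n : ℕ} {φ ψ : MvPolynomial σ A}
    (h : φ * ψ ∈ idealOfVars σ A ^ n) (hφ : coeff 0 φ ≠ 0) : ψ ∈ idealOfVars σ A ^ n := by
  rw [mem_pow_idealOfVars_iff_le_order, coe_mul, MvPowerSeries.order_mul] at h
  rw [mem_pow_idealOfVars_iff_le_order]
  have h0 : (φ : MvPowerSeries σ A).order = 0 := by
    have := MvPowerSeries.order_le (f := (φ : MvPowerSeries σ A)) (d := 0) (by simpa using hφ)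
    simpa using this
  simpa [h0] using h

theorem mem_pow_idealOfVars_of_X_mul [IsDomain A] {n : ℕ} {i : σ} {ψ : MvPolynomial σ A}
    (h : X i * ψ ∈ idealOfVars σ A ^ n) : ψ ∈ idealOfVars σ A ^ (n - 1) := by
  rw [mem_pow_idealOfVars_iff'] at h ⊢
  intro s hs
  have := h (Finsupp.single i 1 + s) (by simp; omega)
  rwa [coeff_X_mul] at this

theorem totalDegree_le_iff_coeff {d : ℕ} {φ : MvPolynomial σ A} :
    φ.totalDegree ≤ d ↔ ∀ s : σ →₀ ℕ, d < s.degree → coeff s φ = 0 := by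
  rw [totalDegree, Finset.sup_le_iff]
  simp only [mem_support_iff]
  refine forall_congr' fun s => ?_
  rw [← not_lt, not_imp_not]
  rfl

end Translate

/-! ### Multiplicities at the vertices of a cube -/

section Cube

variable {E : Type*} [Field E]

/-- The vertex of the unit cube with the given set of coordinates equal to `1`. -/
def cubeVertex (E : Type*) [Field E] {n : ℕ} (a : Fin n → Bool) (i : Fin n) : E :=
  if a i then 1 else 0

/-- Restriction of a polynomial to the hyperplane `x₀ = b`. -/
def restrictHead (n : ℕ) (b : E) : MvPolynomial (Fin (n + 1)) E →ₐ[E] MvPolynomial (Fin n) E :=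
  aeval (Fin.cons (C b) X)

theorem totalDegree_restrictHead_le {n : ℕ} (b : E) (f : MvPolynomial (Fin (n + 1)) E) :
    (restrictHead n b f).totalDegree ≤ f.totalDegree := by
  conv_lhs => rw [f.as_sum, map_sum]
  refine totalDegree_finsetSum_le fun s hs => ?_
  rw [restrictHead, aeval_monomial, Finsupp.prod_fintype _ _ (by simp)]
  refine (totalDegree_mul _ _).trans ?_
  rw [algebraMap_eq, totalDegree_C, zero_add]
  refine (totalDegree_finsetProd _ _).trans ?_
  refine le_trans (Finset.sum_le_sum (g := fun i => s i) fun i _ => ?_) ?_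
  · refine (totalDegree_pow _ _).trans ?_
    refine Fin.cases ?_ (fun j => ?_) i
    · simp
    · simp
  · have := le_totalDegree hs
    rwa [Finsupp.sum_fintype _ _ (by simp)] at this

theorem translate_restrictHead {n : ℕ} (b : E) (y : Fin n → E)
    (f : MvPolynomial (Fin (n + 1)) E) :
    translate y (restrictHead n b f) = restrictHead n 0 (translate (Fin.cons b y) f) := by
  have : (translate y).comp (restrictHead n b) =
      (restrictHead n 0).comp (translate (Fin.cons b y)) := by
    ext i : 1
    refine Fin.cases ?_ (fun j => ?_) i
    · simp [restrictHead, translate, algebraMap_eq]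
    · simp [restrictHead, translate, algebraMap_eq]
  exact DFunLike.congr_fun this f

/-- The factor theorem in the variable `X 0`, via `finSuccEquiv`. -/
theorem exists_eq_mul_of_restrictHead_eq_zero {n : ℕ} {b : E} {f : MvPolynomial (Fin (n + 1)) E}
    (h : restrictHead n b f = 0) : ∃ g, f = (X 0 - C b) * g := by
  have h1 : ∀ f : MvPolynomial (Fin (n + 1)) E,
      (finSuccEquiv E n f).eval (C b) = restrictHead n b f := by
    intro f
    induction f using MvPolynomial.induction_on with
    | C a => simp [restrictHead, finSuccEquiv_apply, algebraMap_eq]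
    | add p q hp hq => simp only [map_add, Polynomial.eval_add, hp, hq]
    | mul_X p i hp =>
      rw [map_mul, map_mul, Polynomial.eval_mul, hp]
      refine Fin.cases ?_ (fun j => ?_) i
      · simp [restrictHead, finSuccEquiv_X_zero]
      · simp [restrictHead, finSuccEquiv_X_succ]
  rw [← h1] at h
  obtain ⟨g, hg⟩ := Polynomial.dvd_iff_isRoot.mpr h
  refine ⟨(finSuccEquiv E n).symm g, (finSuccEquiv E n).injective ?_⟩
  rw [hg, map_mul, map_sub, finSuccEquiv_X_zero, AlgEquiv.apply_symm_apply,
    show finSuccEquiv E n (C b) = Polynomial.C (C b) by simp [finSuccEquiv_apply]]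

/-- Double induction on `n` and `d`. If `f` vanishes on neither of the faces `x₀ = 0` and `x₀ = 1`,
its restrictions keep the multiplicities and the bounds for the two faces add up. If `f` vanishes on
one of them, dividing by its equation lowers the degree by one and the multiplicities by at most
one, only at the vertices of that face. The division destroys uniformity, so `μ` has to vary with
the vertex. -/
theorem sum_multiplicities_cube_le (n : ℕ) : ∀ (d : ℕ) (f : MvPolynomial (Fin n) E), f ≠ 0 →
    f.totalDegree ≤ d → ∀ μ : (Fin n → Bool) → ℕ,
    (∀ a, translate (cubeVertex E a) f ∈ idealOfVars (Fin n) E ^ μ a) →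
    2 * ∑ a, μ a ≤ 2 ^ n * d := by
  induction n with
  | zero =>
    intro d f hf hd μ h
    suffices ∀ a, μ a = 0 by simp [this]
    intro a
    by_contra ha
    obtain ⟨c, rfl⟩ := C_surjective (Fin 0) f
    have h1 := h a
    rw [show translate (cubeVertex E a) (C c) = C c by simp [translate, algebraMap_eq],
      C_mem_pow_idealOfVars_iff] at h1
    rcases h1 with rfl | h1
    · simp at hf
    · exact ha h1
  | succ n ihn =>
    intro d
    induction d with
    | zero =>
      intro f hf hd μ h
      suffices ∀ a, μ a = 0 by simp [this]
      intro a
      by_contra ha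
      obtain ⟨c, rfl⟩ : ∃ c, f = C c := ⟨_, totalDegree_eq_zero_iff_eq_C.mp (by omega)⟩
      have h1 := h a
      rw [show translate (cubeVertex E a) (C c) = C c by simp [translate, algebraMap_eq],
        C_mem_pow_idealOfVars_iff] at h1
      rcases h1 with rfl | h1
      · simp at hf
      · exact ha h1
    | succ d ihd =>
      intro f hf hd μ h
      have hsplit : ∀ ν : (Fin (n + 1) → Bool) → ℕ,
          ∑ a, ν a = ∑ b, ∑ a, ν (Fin.cons b a) := by
        intro ν
        rw [← (Fin.consEquiv fun _ => Bool).sum_comp, Fintype.sum_prod_type]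
        rfl
      have hcons : ∀ (b : Bool) (a : Fin n → Bool), cubeVertex E (Fin.cons b a) =
          (Fin.cons (if b then 1 else 0) (cubeVertex E a) : Fin (n + 1) → E) := by
        intro b a
        funext i
        refine Fin.cases ?_ (fun j => ?_) i <;> simp [cubeVertex]
      by_cases hr : ∃ b : Bool, restrictHead n (if b then (1 : E) else 0) f = 0
      · obtain ⟨b, hb⟩ := hr
        obtain ⟨g, rfl⟩ := exists_eq_mul_of_restrictHead_eq_zero hb
        set c : E := if b then (1 : E) else 0
        have hg : g ≠ 0 := right_ne_zero_of_mul hf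
        have hX : (X 0 - C c : MvPolynomial (Fin (n + 1)) E) ≠ 0 := left_ne_zero_of_mul hf
        have hX1 : (X 0 - C c : MvPolynomial (Fin (n + 1)) E).totalDegree ≠ 0 := by
          intro h0
          rw [totalDegree_eq_zero_iff_eq_C] at h0
          have := congrArg (coeff (Finsupp.single 0 1)) h0
          rw [coeff_sub, coeff_C, coeff_C, if_neg, if_neg] at this
          · simp [coeff_X] at this
          · simp [eq_comm]
          · simp [eq_comm]
        rw [totalDegree_mul_of_isDomain hX hg] at hd
        -- Truncation at `μ a = 0` is harmless: `h2` needs only `μ a ≤ (μ a - 1) + 1`.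
        have := ihd g hg (by omega) (fun a => μ a - if a 0 = b then 1 else 0) fun a => by
          have h1 := h a
          rw [map_mul, map_sub, translate_X, show translate (cubeVertex E a) (C c) = C c by
            simp [translate, algebraMap_eq]] at h1
          split_ifs with hab
          · rw [show cubeVertex E a 0 = c by simp [cubeVertex, c, hab], add_sub_cancel_right] at h1
            exact mem_pow_idealOfVars_of_X_mul h1
          · refine mem_pow_idealOfVars_of_mul_left h1 ?_
            have : cubeVertex E a 0 - c ≠ 0 := by
              simp only [cubeVertex, c]
              revert hab
              cases a 0 <;> cases b <;> simp
            simpa using this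
        have h2 : ∑ a, μ a ≤ ∑ a, (μ a - if a 0 = b then 1 else 0) +
            ∑ a : Fin (n + 1) → Bool, if a 0 = b then 1 else 0 := by
          rw [← Finset.sum_add_distrib]
          exact Finset.sum_le_sum fun a _ => by omega
        have h3 : (∑ a : Fin (n + 1) → Bool, if a 0 = b then 1 else 0) = 2 ^ n := by
          rw [hsplit]
          simp
        rw [h3] at h2
        calc 2 * ∑ a, μ a ≤ 2 * (∑ a, (μ a - if a 0 = b then 1 else 0)) + 2 * 2 ^ n := by omega
          _ ≤ 2 ^ (n + 1) * d + 2 * 2 ^ n := by gcongr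
          _ = 2 ^ (n + 1) * (d + 1) := by ring
      · push Not at hr
        have key : ∀ b : Bool, 2 * ∑ a, μ (Fin.cons b a) ≤ 2 ^ n * (d + 1) := fun b =>
          ihn (d + 1) _ (hr b) ((totalDegree_restrictHead_le _ _).trans hd) _ fun a => by
            have h1 := h (Fin.cons b a)
            rw [hcons] at h1
            rw [translate_restrictHead]
            refine map_mem_pow_idealOfVars_of_X (g := (restrictHead n (0 : E)).toRingHom) ?_ h1
            intro i
            refine Fin.cases ?_ (fun j => ?_) i
            · simp [restrictHead]
            · simpa [restrictHead] using Ideal.subset_span (Set.mem_range_self j)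
        rw [hsplit, Finset.mul_sum]
        calc ∑ b, 2 * ∑ a, μ (Fin.cons b a) ≤ ∑ _b : Bool, 2 ^ n * (d + 1) :=
              Finset.sum_le_sum fun b _ => key b
          _ = 2 ^ (n + 1) * (d + 1) := by simp; ring

/-- A polynomial with multiplicity at least `k` at all vertices of a cube has degree at least
`2 * k`. -/
theorem two_mul_le_of_multiplicity_cube {n d k : ℕ} {f : MvPolynomial (Fin n) E} (hf : f ≠ 0)
    (hd : f.totalDegree ≤ d)
    (h : ∀ a, translate (cubeVertex E a) f ∈ idealOfVars (Fin n) E ^ k) : 2 * k ≤ d := by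
  have := sum_multiplicities_cube_le n d f hf hd (fun _ => k) h
  simp only [Finset.sum_const, Finset.card_univ, Fintype.card_fun, Fintype.card_bool,
    Fintype.card_fin, smul_eq_mul] at this
  have h2 : 2 ^ n * (2 * k) ≤ 2 ^ n * d := by linarith
  exact Nat.le_of_mul_le_mul_left h2 (by positivity)

end Cube

/-! ### Interpolants with prescribed multiplicities -/

section Interpolant

variable {ι σ A B : Type*} [CommRing A] [CommRing B]

/-- There is a nonzero polynomial of degree at most `d` with multiplicity at least `a j` at `y j`
for all `j`. -/
def HasInterpolant (y : ι → σ → A) (a : ι → ℕ) (d : ℕ) : Prop :=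
  ∃ φ : MvPolynomial σ A, φ ≠ 0 ∧ φ.totalDegree ≤ d ∧
    ∀ j, translate (y j) φ ∈ idealOfVars σ A ^ a j

theorem HasInterpolant.comp {κ : Type*} {y : ι → σ → A} {a : ι → ℕ} {d : ℕ}
    (h : HasInterpolant y a d) (e : κ → ι) : HasInterpolant (y ∘ e) (a ∘ e) d := by
  obtain ⟨φ, h0, hd, hv⟩ := h
  exact ⟨φ, h0, hd, fun j => hv (e j)⟩

theorem HasInterpolant.mul [IsDomain A] {y : ι → σ → A} {a b : ι → ℕ} {d e : ℕ}
    (h : HasInterpolant y a d) (h' : HasInterpolant y b e) :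
    HasInterpolant y (a + b) (d + e) := by
  obtain ⟨φ, h0, hd, hv⟩ := h
  obtain ⟨ψ, h0', hd', hv'⟩ := h'
  refine ⟨φ * ψ, mul_ne_zero h0 h0', (totalDegree_mul _ _).trans (by omega), fun j => ?_⟩
  rw [map_mul, Pi.add_apply, pow_add]
  exact Ideal.mul_mem_mul (hv j) (hv' j)

/-- A product of powers of hyperplanes through the points. It keeps `genericAlpha` from being the
default value of `sInf ∅`. -/
theorem HasInterpolant.exists [IsDomain A] [Finite ι] [Nonempty σ] (y : ι → σ → A) (a : ι → ℕ) :
    ∃ d, HasInterpolant y a d := by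
  classical
  cases nonempty_fintype ι
  let i : σ := Classical.arbitrary σ
  refine ⟨_, ∏ j, (X i - C (y j i)) ^ a j, ?_, le_rfl, fun j => ?_⟩
  · refine Finset.prod_ne_zero_iff.mpr fun j _ => pow_ne_zero _ fun h => ?_
    have := congrArg (coeff (Finsupp.single i 1)) h
    rw [coeff_sub, coeff_C, if_neg (by simp [eq_comm])] at this
    simp at this
  · rw [map_prod]
    refine Ideal.mem_of_dvd _ (Finset.dvd_prod_of_mem _ (Finset.mem_univ j)) ?_
    rw [map_pow]
    refine Ideal.pow_mem_pow ?_ _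
    simpa [translate, algebraMap_eq] using Ideal.subset_span (Set.mem_range_self i)

theorem mem_pow_idealOfVars_of_map {g : A →+* B} (hg : Function.Injective g) {n : ℕ}
    {φ : MvPolynomial σ A} (h : map g φ ∈ idealOfVars σ B ^ n) : φ ∈ idealOfVars σ A ^ n := by
  rw [mem_pow_idealOfVars_iff'] at h ⊢
  intro s hs
  have := h s hs
  rw [coeff_map] at this
  exact hg (this.trans (map_zero g).symm)

theorem HasInterpolant.of_isFractionRing [IsDomain A] {F : Type*} [Field F] [Algebra A F]
    [IsFractionRing A F] {y : ι → σ → A} {a : ι → ℕ} {d : ℕ}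
    (h : HasInterpolant (fun j i => algebraMap A F (y j i)) a d) : HasInterpolant y a d := by
  obtain ⟨φ, h0, hd, hv⟩ := h
  obtain ⟨b, hb⟩ := IsLocalization.exist_integer_multiples (nonZeroDivisors A) φ.support
    fun s => coeff s φ
  have hb0 : algebraMap A F b ≠ 0 := IsFractionRing.to_map_ne_zero_of_mem_nonZeroDivisors b.2
  choose! c hc using hb
  let ψ : MvPolynomial σ A := ∑ s ∈ φ.support, monomial s (c s)
  have hψ : map (algebraMap A F) ψ = C (algebraMap A F b) * φ := by
    conv_rhs => rw [φ.as_sum, Finset.mul_sum]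
    rw [map_sum]
    refine Finset.sum_congr rfl fun s hs => ?_
    rw [map_monomial, hc s hs, C_mul_monomial, Algebra.smul_def]
  have hinj := IsFractionRing.injective A F
  refine ⟨ψ, fun h => ?_, ?_, fun j => ?_⟩
  · rw [h, map_zero, eq_comm, mul_eq_zero] at hψ
    rcases hψ with hψ | hψ
    · exact hb0 (C_eq_zero.mp hψ)
    · exact h0 hψ
  · rw [totalDegree_le_iff_coeff] at hd ⊢
    intro s hs
    have := congrArg (coeff s) hψ
    rw [coeff_map, coeff_C_mul, hd s hs, mul_zero] at this
    exact hinj (this.trans (map_zero _).symm)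
  · refine mem_pow_idealOfVars_of_map hinj ?_
    rw [map_translate, hψ, map_mul]
    exact Ideal.mul_mem_left _ _ (hv j)

end Interpolant

/-! ### Specialisation at `t = 0` -/

section Specialization

variable {ι σ E : Type*} [CommRing E] [IsDomain E]

/-- Cancel `t` as long as the reduction at `t = 0` vanishes; each time the degree in `t` of a fixed
nonzero coefficient drops. -/
theorem exists_eq_C_X_pow_mul {φ : MvPolynomial σ (Polynomial E)} (hφ : φ ≠ 0) :
    ∃ (e : ℕ) (ψ : MvPolynomial σ (Polynomial E)),
      φ = C (Polynomial.X ^ e) * ψ ∧ map (Polynomial.evalRingHom 0) ψ ≠ 0 := by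
  obtain ⟨s, hs⟩ := ne_zero_iff.mp hφ
  obtain ⟨n, hn⟩ : ∃ n, n = (coeff s φ).natDegree := ⟨_, rfl⟩
  induction n using Nat.strong_induction_on generalizing φ with
  | _ n ih =>
    by_cases h : map (Polynomial.evalRingHom 0) φ = 0
    · have hX : C Polynomial.X ∣ φ := by
        rw [C_dvd_iff_dvd_coeff]
        intro i
        rw [Polynomial.X_dvd_iff, Polynomial.coeff_zero_eq_eval_zero]
        have := congrArg (coeff i) h
        rwa [coeff_map, coeff_zero] at this
      obtain ⟨ψ, rfl⟩ := hX
      have h1 : coeff s (C Polynomial.X * ψ) = Polynomial.X * coeff s ψ := coeff_C_mul _ _ _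
      rw [h1] at hs hn
      have hs' := right_ne_zero_of_mul hs
      rw [Polynomial.natDegree_X_mul hs'] at hn
      obtain ⟨e, χ, rfl, hχ⟩ := ih _ (by omega) (right_ne_zero_of_mul hφ) hs' rfl
      exact ⟨e + 1, χ, by rw [pow_succ', C_mul, mul_assoc], hχ⟩
    · exact ⟨0, φ, by simp, h⟩

/-- An interpolant over `E[t]` can be chosen such that it does not vanish at `t = 0`. -/
theorem HasInterpolant.exists_map_ne_zero {y : ι → σ → Polynomial E} {a : ι → ℕ} {d : ℕ}
    (h : HasInterpolant y a d) : ∃ φ : MvPolynomial σ (Polynomial E),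
      map (Polynomial.evalRingHom 0) φ ≠ 0 ∧ φ.totalDegree ≤ d ∧
        ∀ j, translate (y j) φ ∈ idealOfVars σ (Polynomial E) ^ a j := by
  obtain ⟨φ, h0, hd, hv⟩ := h
  obtain ⟨e, ψ, rfl, hψ⟩ := exists_eq_C_X_pow_mul h0
  have hX : (Polynomial.X : Polynomial E) ^ e ≠ 0 := pow_ne_zero _ Polynomial.X_ne_zero
  refine ⟨ψ, hψ, ?_, fun j => ?_⟩
  · rw [totalDegree_le_iff_coeff] at hd ⊢
    intro s hs
    have := hd s hs
    rw [coeff_C_mul] at this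
    exact (mul_eq_zero.mp this).resolve_left hX
  · have := hv j
    rw [map_mul, show translate (y j) (C (Polynomial.X ^ e)) = C (Polynomial.X ^ e) by
      simp [translate, algebraMap_eq]] at this
    exact mem_pow_idealOfVars_of_C_mul hX this

theorem totalDegree_map_le {A B : Type*} [CommRing A] [CommRing B] (g : A →+* B) {d : ℕ}
    {φ : MvPolynomial σ A} (h : φ.totalDegree ≤ d) : (map g φ).totalDegree ≤ d := by
  rw [totalDegree_le_iff_coeff] at h ⊢
  intro s hs
  rw [coeff_map, h s hs, map_zero]

theorem HasInterpolant.eval_zero {y : ι → σ → Polynomial E} {a : ι → ℕ} {d : ℕ}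
    (h : HasInterpolant y a d) : HasInterpolant (fun j i => (y j i).eval 0) a d := by
  obtain ⟨φ, h0, hd, hv⟩ := h.exists_map_ne_zero
  refine ⟨_, h0, totalDegree_map_le _ hd, fun j => ?_⟩
  have := map_mem_pow_idealOfVars (Polynomial.evalRingHom 0) (hv j)
  rwa [map_translate] at this

/-- The points whose coordinates are independent variables over `K`. -/
def genericPoints (K ι σ : Type*) [CommRing K] (j : ι) (i : σ) : MvPolynomial (ι × σ) K :=
  X (j, i)

/-- If there is an interpolant at generic points, then there is one at arbitrary points. -/
theorem HasInterpolant.of_generic {K : Type*} [Field K] {a : ι → ℕ} {d : ℕ}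
    (h : HasInterpolant (genericPoints K ι σ) a d) {L : Type*} [Field L] [Infinite L]
    [Algebra K L] (v : ι → σ → L) : HasInterpolant v a d := by
  obtain ⟨φ, h0, hd, hv⟩ := h
  obtain ⟨s, hs⟩ := ne_zero_iff.mp h0
  obtain ⟨b, hb⟩ : ∃ b : ι × σ → L, aeval b (coeff s φ) ≠ 0 := by
    by_contra! hb
    refine hs (map_injective (algebraMap K L) (algebraMap K L).injective ?_)
    rw [map_zero]
    refine MvPolynomial.funext fun b => ?_
    simpa [eval_map, aeval_def] using hb b
  -- The line from `v` at `t = 0` to `b` at `t = 1`: the coefficient that is nonzero at `b` keeps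
  -- `φ` nonzero along it.
  let g : MvPolynomial (ι × σ) K →ₐ[K] Polynomial L :=
    aeval fun p => Polynomial.C (v p.1 p.2) + Polynomial.X * Polynomial.C (b p - v p.1 p.2)
  have hg : HasInterpolant (fun j i => g (genericPoints K ι σ j i)) a d := by
    refine ⟨map g.toRingHom φ, fun h => ?_, totalDegree_map_le _ hd, fun j => ?_⟩
    · have h1 := congrArg (fun ψ => (coeff s ψ).eval 1) h
      simp only [coeff_map, coeff_zero, Polynomial.eval_zero] at h1
      have h2 : (Polynomial.evalRingHom (1 : L)).comp g.toRingHom =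
          (aeval b : MvPolynomial (ι × σ) K →ₐ[K] L).toRingHom := by
        ext p
        · simp [g]
        · simp [g]
      exact hb ((DFunLike.congr_fun h2 _).symm.trans h1)
    · have := map_mem_pow_idealOfVars g.toRingHom (hv j)
      rwa [map_translate] at this
  have := hg.eval_zero
  convert this using 3 with j i
  simp [g, genericPoints]

end Specialization

/-! ### Collision of the vertices of a cube -/

section Collision

variable {ι E : Type*} [Field E]

/-- If points of multiplicity `k` at the vertices of a cube collide, then the limit of interpolants
has multiplicity `2 * k` at the limit point. -/
theorem HasInterpolant.collision {n : ℕ} {u : Fin n → E} {w : ι → Fin n → E} {k d : ℕ}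
    {a : ι → ℕ}
    (h : HasInterpolant (Sum.elim
      (fun (b : Fin n → Bool) i => Polynomial.C (u i) + Polynomial.X * Polynomial.C (cubeVertex E b i))
      (fun j i => Polynomial.C (w j i))) (Sum.elim (fun _ => k) a) d) :
    HasInterpolant (Sum.elim (fun _ : Unit => u) w) (Sum.elim (fun _ => 2 * k) a) d := by
  obtain ⟨φ, h0, hd, hv⟩ := h.exists_map_ne_zero
  refine ⟨_, h0, totalDegree_map_le _ hd, ?_⟩
  have key : translate u (map (Polynomial.evalRingHom 0) φ) ∈ idealOfVars (Fin n) E ^ (2 * k) := by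
    -- Here `ψ = φ(u + X)`, and `S` is the rescaling `X ↦ tX`, so that `S ψ = φ(u + tX)`.
    let ψ := translate (fun i => Polynomial.C (u i)) φ
    let S : MvPolynomial (Fin n) (Polynomial E) →ₐ[Polynomial E]
      MvPolynomial (Fin n) (Polynomial E) := aeval fun i => C Polynomial.X * X i
    have hSc : ∀ (χ : MvPolynomial (Fin n) (Polynomial E)) (s : Fin n →₀ ℕ),
        coeff s (S χ) = Polynomial.X ^ s.degree * coeff s χ := by
      intro χ s
      conv_lhs => rw [χ.as_sum, map_sum, coeff_sum]
      have : ∀ r : Fin n →₀ ℕ, S (monomial r (coeff r χ)) =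
          monomial r (Polynomial.X ^ r.degree * coeff r χ) := by
        intro r
        rw [aeval_monomial, monomial_eq, algebraMap_eq, Finsupp.prod_fintype _ _ (by simp),
          Finsupp.prod_fintype _ _ (by simp)]
        simp only [mul_pow, Finset.prod_mul_distrib]
        rw [Finset.prod_pow_eq_pow_sum, ← Finsupp.degree_eq_sum, C_mul, C_pow]
        ring
      simp only [this, coeff_monomial]
      rw [Finset.sum_ite_eq' χ.support s]
      split_ifs with hs
      · rfl
      · rw [notMem_support_iff.mp hs, mul_zero]
    have hψ0 : ψ ≠ 0 := by
      intro h
      have := (map_eq_zero_iff _ (translate_injective _)).mp h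
      rw [this, map_zero] at h0
      exact h0 rfl
    have hX : ∀ r, (Polynomial.X : Polynomial E) ^ r ≠ 0 := fun r =>
      pow_ne_zero _ Polynomial.X_ne_zero
    have hSψ0 : S ψ ≠ 0 := by
      obtain ⟨s, hs⟩ := ne_zero_iff.mp hψ0
      refine ne_zero_iff.mpr ⟨s, ?_⟩
      rw [hSc]
      exact mul_ne_zero (hX _) hs
    obtain ⟨e, χ, hχ, hχ0⟩ := exists_eq_C_X_pow_mul hSψ0
    -- This comparison is used twice: `t` divides the coefficients of `χ` in degrees above `e`, and
    -- those of `ψ` in degrees below `e`.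
    have hcoeff : ∀ s : Fin n →₀ ℕ,
        Polynomial.X ^ s.degree * coeff s ψ = Polynomial.X ^ e * coeff s χ := by
      intro s
      rw [← hSc, hχ, coeff_C_mul]
    have hdeg : (map (Polynomial.evalRingHom 0) χ).totalDegree ≤ e := by
      rw [totalDegree_le_iff_coeff]
      intro s hs
      obtain ⟨r, hr⟩ := Nat.exists_eq_add_of_lt hs
      have h1 := hcoeff s
      rw [hr, add_assoc, pow_add, mul_assoc] at h1
      rw [coeff_map, ← mul_left_cancel₀ (hX e) h1]
      simp
    have hek : 2 * k ≤ e := by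
      refine two_mul_le_of_multiplicity_cube hχ0 hdeg fun b => ?_
      have h1 := hv (Sum.inl b)
      simp only [Sum.elim_inl] at h1
      -- Rescaling moves the vertex `u + t b` to the vertex `b` of the unit cube.
      have hST : S (translate (fun i => Polynomial.C (u i) +
            Polynomial.X * Polynomial.C (cubeVertex E b i)) φ) =
          translate (fun i => Polynomial.C (cubeVertex E b i)) (S ψ) := by
        have : S.comp (translate (fun i => Polynomial.C (u i) +
            Polynomial.X * Polynomial.C (cubeVertex E b i))) =
          ((translate (fun i => Polynomial.C (cubeVertex E b i))).comp S).comp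
            (translate fun i => Polynomial.C (u i)) := by
          ext i : 1
          simp [S, translate, algebraMap_eq]
          ring
        exact DFunLike.congr_fun this φ
      have h2 : S (translate (fun i => Polynomial.C (u i) +
            Polynomial.X * Polynomial.C (cubeVertex E b i)) φ) ∈
          idealOfVars (Fin n) (Polynomial E) ^ k := by
        refine map_mem_pow_idealOfVars_of_X (g := S.toRingHom) (fun i => ?_) h1
        have : S (X i) = C Polynomial.X * X i := by simp [S]
        exact this ▸ Ideal.mul_mem_left _ _ (Ideal.subset_span (Set.mem_range_self i))
      rw [hST, hχ, map_mul, show ∀ z : Fin n → Polynomial E,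
        translate z (C (Polynomial.X ^ e)) = C (Polynomial.X ^ e) by
          intro z; simp [translate, algebraMap_eq]] at h2
      have h3 := map_mem_pow_idealOfVars (Polynomial.evalRingHom 0)
        (mem_pow_idealOfVars_of_C_mul (hX e) h2)
      rw [map_translate] at h3
      simpa using h3
    have hψu : translate u (map (Polynomial.evalRingHom 0) φ) =
        map (Polynomial.evalRingHom 0) ψ := by
      rw [map_translate]
      simp
    rw [hψu, mem_pow_idealOfVars_iff']
    intro s hs
    obtain ⟨r, hr⟩ := Nat.exists_eq_add_of_lt (hs.trans_le hek)
    have h1 := hcoeff s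
    rw [hr, add_assoc, pow_add, mul_assoc] at h1
    rw [coeff_map, mul_left_cancel₀ (hX _) h1]
    simp
  rintro (_ | j)
  · exact key
  · have := map_mem_pow_idealOfVars (Polynomial.evalRingHom 0) (hv (Sum.inr j))
    rw [map_translate] at this
    simpa using this

end Collision

/-! ### Nonexistence of interpolants is an open condition -/

section Openness

variable {ι σ : Type*}

instance finite_degree_le [Finite σ] (d : ℕ) : Finite {s : σ →₀ ℕ // s.degree ≤ d} := by
  classical
  refine Set.Finite.subset (Set.finite_Icc 0 (Finsupp.equivFunOnFinite.symm fun _ => d)) ?_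
  intro s hs
  refine ⟨zero_le, fun i => ?_⟩
  exact (Finsupp.le_degree i s).trans hs

instance finite_degree_lt [Finite σ] (d : ℕ) : Finite {s : σ →₀ ℕ // s.degree < d} :=
  Finite.of_injective (fun s => (⟨s.1, s.2.le⟩ : {s : σ →₀ ℕ // s.degree ≤ d}))
    fun _ _ h => Subtype.ext (congrArg (fun x => x.1) h)

/-- The matrix of the linear conditions on the coefficients of a polynomial of degree at most `d`
that express multiplicity at least `a j` at `y j` for all `j`. -/
def interpolationMatrix {A : Type*} [CommRing A] (y : ι → σ → A) (a : ι → ℕ) (d : ℕ) :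
    Matrix (Σ j, {s : σ →₀ ℕ // s.degree < a j}) {s : σ →₀ ℕ // s.degree ≤ d} A :=
  fun r c => coeff r.2.1 (translate (y r.1) (monomial c.1 1))

theorem interpolationMatrix_map {A B : Type*} [CommRing A] [CommRing B] (g : A →+* B)
    (y : ι → σ → A) (a : ι → ℕ) (d : ℕ) :
    (interpolationMatrix y a d).map g = interpolationMatrix (fun j i => g (y j i)) a d := by
  ext r c
  simp only [Matrix.map_apply, interpolationMatrix]
  rw [← coeff_map, map_translate, map_monomial, map_one]

theorem hasInterpolant_iff_exists_mulVec {A : Type*} [CommRing A] (y : ι → σ → A) (a : ι → ℕ)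
    (d : ℕ) [Fintype {s : σ →₀ ℕ // s.degree ≤ d}] :
    HasInterpolant y a d ↔ ∃ x ≠ 0, (interpolationMatrix y a d).mulVec x = 0 := by
  classical
  let φ (x : {s : σ →₀ ℕ // s.degree ≤ d} → A) : MvPolynomial σ A := ∑ c, monomial c.1 (x c)
  have hφ : ∀ x r, (interpolationMatrix y a d).mulVec x r =
      coeff r.2.1 (translate (y r.1) (φ x)) := by
    intro x r
    simp only [φ, map_sum, coeff_sum, Matrix.mulVec, dotProduct, interpolationMatrix]
    refine Finset.sum_congr rfl fun c _ => ?_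
    rw [show monomial c.1 (x c) = x c • monomial c.1 (1 : A) by simp [smul_monomial], map_smul,
      coeff_smul, smul_eq_mul, mul_comm]
  have hc : ∀ x s, coeff s (φ x) = if h : s.degree ≤ d then x ⟨s, h⟩ else 0 := by
    intro x s
    simp only [φ, coeff_sum, coeff_monomial]
    split_ifs with h
    · rw [Finset.sum_eq_single ⟨s, h⟩]
      · simp
      · intro c _ hc
        exact if_neg fun h' => hc (Subtype.ext h')
      · simp
    · refine Finset.sum_eq_zero fun c _ => if_neg fun (h' : c.1 = s) => h (h' ▸ c.2)
  constructor
  · rintro ⟨ψ, h0, hd, hv⟩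
    rw [totalDegree_le_iff_coeff] at hd
    have hψ : φ (fun c => coeff c.1 ψ) = ψ := by
      ext s
      rw [hc]
      split_ifs with h
      · rfl
      · rw [hd s (not_le.mp h)]
    refine ⟨fun c => coeff c.1 ψ, fun h => h0 ?_, ?_⟩
    · rw [← hψ, h]
      simp [φ]
    · funext r
      rw [hφ, hψ]
      exact (mem_pow_idealOfVars_iff' _ _).mp (hv r.1) _ r.2.2
  · rintro ⟨x, hx, h⟩
    refine ⟨φ x, fun h0 => hx ?_, ?_, fun j => ?_⟩
    · funext c
      have := hc x c.1
      rw [h0, dif_pos c.2] at this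
      simpa using this.symm
    · rw [totalDegree_le_iff_coeff]
      intro s hs
      rw [hc, dif_neg (not_le.mpr hs)]
    · rw [mem_pow_idealOfVars_iff']
      intro s hs
      rw [← hφ x ⟨j, s, hs⟩, h, Pi.zero_apply]

/-- A left inverse over the fraction field with its denominators cleared. The identity survives
every specialisation, so `M` stays injective over a field wherever `b` does not vanish. -/
theorem exists_mul_eq_smul_one_of_ker_eq_bot {m n R : Type*} [Fintype m] [Fintype n]
    [DecidableEq n] [CommRing R] [IsDomain R] (F : Type*) [Field F] [Algebra R F]
    [IsFractionRing R F] {M : Matrix m n R}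
    (h : LinearMap.ker (M.map (algebraMap R F)).mulVecLin = ⊥) :
    ∃ (b : R) (B : Matrix n m R), b ≠ 0 ∧ B * M = b • (1 : Matrix n n R) := by
  classical
  obtain ⟨g, hg⟩ := LinearMap.exists_leftInverse_of_injective _ h
  have hB : LinearMap.toMatrix' g * M.map (algebraMap R F) = 1 := by
    have := congrArg LinearMap.toMatrix' hg
    rwa [LinearMap.toMatrix'_comp, LinearMap.toMatrix'_id, ← Matrix.toLin'_apply',
      LinearMap.toMatrix'_toLin'] at this
  obtain ⟨b, hb⟩ := IsLocalization.exist_integer_multiples_of_finite (nonZeroDivisors R)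
    fun p : n × m => LinearMap.toMatrix' g p.1 p.2
  choose B hB' using hb
  refine ⟨b, Matrix.of fun c r => B (c, r), nonZeroDivisors.ne_zero b.2,
    Matrix.map_injective (IsFractionRing.injective R F) ?_⟩
  have h1 : (Matrix.of fun c r => B (c, r)).map (algebraMap R F) =
      algebraMap R F b • LinearMap.toMatrix' g := by
    ext c r
    rw [Matrix.map_apply, Matrix.of_apply, hB', Matrix.smul_apply, Algebra.smul_def, smul_eq_mul]
  dsimp only
  rw [Matrix.map_mul, h1, Matrix.smul_mul, hB]
  ext c c'
  by_cases hc : c = c' <;> simp [hc]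

/-- If there is no interpolant at generic points, then there is none at the points of a nonempty
open set. -/
theorem exists_forall_not_hasInterpolant {K : Type*} [Field K] [Finite ι] [Finite σ]
    {a : ι → ℕ} {d : ℕ} (h : ¬ HasInterpolant (genericPoints K ι σ) a d) :
    ∃ F : MvPolynomial (ι × σ) K, F ≠ 0 ∧ ∀ (L : Type u) [Field L] [Algebra K L] (v : ι → σ → L),
      aeval (fun p : ι × σ => v p.1 p.2) F ≠ 0 → ¬ HasInterpolant v a d := by
  classical
  cases nonempty_fintype {s : σ →₀ ℕ // s.degree ≤ d}
  cases nonempty_fintype (Σ j, {s : σ →₀ ℕ // s.degree < a j})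
  obtain ⟨b, B, hb, hBM⟩ := exists_mul_eq_smul_one_of_ker_eq_bot
    (FractionRing (MvPolynomial (ι × σ) K)) (M := interpolationMatrix (genericPoints K ι σ) a d) <| by
      rw [Submodule.eq_bot_iff]
      intro x hx
      by_contra hx0
      refine h (HasInterpolant.of_isFractionRing (F := FractionRing (MvPolynomial (ι × σ) K)) ?_)
      rw [hasInterpolant_iff_exists_mulVec, ← interpolationMatrix_map]
      exact ⟨x, hx0, hx⟩
  refine ⟨b, hb, fun L _ _ v hv hint => ?_⟩
  rw [hasInterpolant_iff_exists_mulVec] at hint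
  obtain ⟨x, hx0, hx⟩ := hint
  set ev : MvPolynomial (ι × σ) K →+* L :=
    (aeval fun p : ι × σ => v p.1 p.2 : MvPolynomial (ι × σ) K →ₐ[K] L).toRingHom with hev
  have hML : (interpolationMatrix (genericPoints K ι σ) a d).map ev = interpolationMatrix v a d := by
    rw [interpolationMatrix_map]
    congr 1
    funext j i
    simp [hev, genericPoints]
  have h3 := congrArg (fun N => (N.map ev).mulVec x) hBM
  simp only [Matrix.map_mul, hML, ← Matrix.mulVec_mulVec, hx, Matrix.mulVec_zero] at h3
  have h6 : (b • (1 : Matrix {s : σ →₀ ℕ // s.degree ≤ d} {s : σ →₀ ℕ // s.degree ≤ d}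
      (MvPolynomial (ι × σ) K))).map ev = ev b • (1 : Matrix _ _ L) := by
    ext c c'
    by_cases hc : c = c' <;> simp [hc]
  rw [h6, Matrix.smul_mulVec, Matrix.one_mulVec] at h3
  exact hx0 (funext fun c => (mul_eq_zero.mp (congrFun h3 c).symm).resolve_left hv)

end Openness

/-! ### Joint homogeneity over `L[T]` -/

section Bigraded

variable {σ L : Type*} [CommRing L]

/-- Homogeneity of degree `d` of a polynomial in the variables `σ` and `T`, regarded as a
polynomial in the variables `σ` over `L[T]`. -/
def JointlyHomogeneous (d : ℕ) (g : MvPolynomial σ (Polynomial L)) : Prop :=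
  ∀ (s : σ →₀ ℕ) (n : ℕ), n + s.degree ≠ d → (coeff s g).coeff n = 0

theorem JointlyHomogeneous.add {d : ℕ} {f g : MvPolynomial σ (Polynomial L)}
    (hf : JointlyHomogeneous d f) (hg : JointlyHomogeneous d g) : JointlyHomogeneous d (f + g) := by
  intro s n h
  rw [coeff_add, Polynomial.coeff_add, hf s n h, hg s n h, add_zero]

theorem JointlyHomogeneous.sum {ι : Type*} {d : ℕ} {t : Finset ι}
    {f : ι → MvPolynomial σ (Polynomial L)} (hf : ∀ i ∈ t, JointlyHomogeneous d (f i)) :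
    JointlyHomogeneous d (∑ i ∈ t, f i) := by
  intro s n h
  rw [coeff_sum, Polynomial.finsetSum_coeff]
  exact Finset.sum_eq_zero fun i hi => hf i hi s n h

theorem JointlyHomogeneous.mul {d e : ℕ} {f g : MvPolynomial σ (Polynomial L)}
    (hf : JointlyHomogeneous d f) (hg : JointlyHomogeneous e g) :
    JointlyHomogeneous (d + e) (f * g) := by
  classical
  intro s n h
  rw [coeff_mul, Polynomial.finsetSum_coeff]
  refine Finset.sum_eq_zero fun p hp => ?_
  rw [Polynomial.coeff_mul]
  refine Finset.sum_eq_zero fun q hq => ?_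
  rw [Finset.HasAntidiagonal.mem_antidiagonal] at hp hq
  by_cases h1 : q.1 + p.1.degree = d
  · rw [hg p.2 q.2, mul_zero]
    intro h2
    apply h
    rw [← hp, ← hq, map_add]
    omega
  · rw [hf p.1 q.1 h1, zero_mul]

theorem jointlyHomogeneous_C_C (c : L) :
    JointlyHomogeneous 0 (C (Polynomial.C c) : MvPolynomial σ (Polynomial L)) := by
  classical
  intro s n h
  rw [coeff_C]
  split_ifs with hs
  · subst hs
    rw [Polynomial.coeff_C_of_ne_zero]
    simpa using h
  · simp

theorem JointlyHomogeneous.pow {d : ℕ} {f : MvPolynomial σ (Polynomial L)}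
    (hf : JointlyHomogeneous d f) (n : ℕ) : JointlyHomogeneous (n * d) (f ^ n) := by
  induction n with
  | zero => simpa using jointlyHomogeneous_C_C (1 : L)
  | succ n ih =>
    rw [pow_succ, Nat.succ_mul]
    exact ih.mul hf

theorem JointlyHomogeneous.prod {ι : Type*} {t : Finset ι} {d : ι → ℕ}
    {f : ι → MvPolynomial σ (Polynomial L)} (hf : ∀ i ∈ t, JointlyHomogeneous (d i) (f i)) :
    JointlyHomogeneous (∑ i ∈ t, d i) (∏ i ∈ t, f i) := by
  classical
  induction t using Finset.induction_on with
  | empty => simpa using jointlyHomogeneous_C_C (1 : L)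
  | insert i t hi ih =>
    rw [Finset.sum_insert hi, Finset.prod_insert hi]
    exact (hf i (Finset.mem_insert_self i t)).mul
      (ih fun j hj => hf j (Finset.mem_insert_of_mem hj))

theorem jointlyHomogeneous_C_X :
    JointlyHomogeneous 1 (C Polynomial.X : MvPolynomial σ (Polynomial L)) := by
  classical
  intro s n h
  rw [coeff_C]
  split_ifs with hs
  · subst hs
    rw [Polynomial.coeff_X, if_neg]
    rintro rfl
    simp at h
  · simp

theorem jointlyHomogeneous_X (i : σ) :
    JointlyHomogeneous 1 (X i : MvPolynomial σ (Polynomial L)) := by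
  classical
  intro s n h
  rw [coeff_X]
  split_ifs with hs
  · subst hs
    rw [Polynomial.coeff_one, if_neg]
    rintro rfl
    simp at h
  · simp

/-- Only one power of `T` can occur in each coefficient, so setting `T = 1` loses nothing. -/
theorem JointlyHomogeneous.coeff_eq_zero {d : ℕ} {g : MvPolynomial σ (Polynomial L)}
    (hg : JointlyHomogeneous d g) {s : σ →₀ ℕ}
    (h : coeff s (map (Polynomial.evalRingHom 1) g) = 0) : coeff s g = 0 := by
  ext n
  rw [Polynomial.coeff_zero]
  by_cases hn : n + s.degree = d
  · rw [coeff_map, Polynomial.coe_evalRingHom, Polynomial.eval_eq_sum, Polynomial.sum_def] at h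
    simp only [one_pow, mul_one] at h
    by_contra h0
    rw [Finset.sum_eq_single_of_mem n (Polynomial.mem_support_iff.mpr h0)] at h
    · exact h0 h
    · intro b _ hb
      exact hg s b (by omega)
  · exact hg s n hn

theorem JointlyHomogeneous.eq_zero {d : ℕ} {g : MvPolynomial σ (Polynomial L)}
    (hg : JointlyHomogeneous d g) (h : map (Polynomial.evalRingHom 1) g = 0) : g = 0 := by
  ext1 s
  rw [coeff_zero]
  exact hg.coeff_eq_zero (by rw [h, coeff_zero])

theorem JointlyHomogeneous.mem_pow_idealOfVars_iff {d a : ℕ} {g : MvPolynomial σ (Polynomial L)}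
    (hg : JointlyHomogeneous d g) : g ∈ idealOfVars σ (Polynomial L) ^ a ↔
      map (Polynomial.evalRingHom 1) g ∈ idealOfVars σ L ^ a := by
  refine ⟨map_mem_pow_idealOfVars _, fun h => ?_⟩
  rw [mem_pow_idealOfVars_iff'] at h ⊢
  exact fun s hs => hg.coeff_eq_zero (h s hs)

end Bigraded

/-! ### Passage from forms to affine polynomials -/

section Dehomogenization

variable {L : Type*} [Field L] {N : ℕ}

/-- The polynomial `f(1, X)`. -/
def dehomogenize (N : ℕ) : MvPolynomial (Fin (N + 1)) L →ₐ[L] MvPolynomial (Fin N) L :=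
  aeval (Fin.cons 1 X)

/-- The coordinate change that moves the point `(1 : y)` to `(1 : 0)`, with the variable `X 0`
regarded as a scalar. -/
def centerAt (y : Fin N → L) :
    MvPolynomial (Fin (N + 1)) L →ₐ[L] MvPolynomial (Fin N) (Polynomial L) :=
  aeval (Fin.cons (C Polynomial.X) fun i => X i + C (Polynomial.C (y i)) * C Polynomial.X)

/-- The inverse of `centerAt y`. -/
def uncenterAt (y : Fin N → L) :
    MvPolynomial (Fin N) (Polynomial L) →+* MvPolynomial (Fin (N + 1)) L :=
  eval₂Hom (Polynomial.eval₂RingHom C (X 0)) fun i => X i.succ - C (y i) * X 0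

theorem uncenterAt_centerAt (y : Fin N → L) (f : MvPolynomial (Fin (N + 1)) L) :
    uncenterAt y (centerAt y f) = f := by
  have : (uncenterAt y).comp (centerAt y).toRingHom = RingHom.id _ := by
    refine MvPolynomial.ringHom_ext (fun c => ?_) fun i => ?_
    · simp [uncenterAt, centerAt, MvPolynomial.algebraMap_apply]
    · refine Fin.cases ?_ (fun j => ?_) i
      · simp [uncenterAt, centerAt]
      · simp [uncenterAt, centerAt]
  exact DFunLike.congr_fun this f

theorem centerAt_injective (y : Fin N → L) : Function.Injective (centerAt y) :=
  Function.LeftInverse.injective (uncenterAt_centerAt y)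

theorem map_centerAt (y : Fin N → L) (f : MvPolynomial (Fin (N + 1)) L) :
    map (Polynomial.evalRingHom 1) (centerAt y f) = translate y (dehomogenize N f) := by
  have : (map (Polynomial.evalRingHom (1 : L))).comp (centerAt y).toRingHom =
      ((translate y).comp (dehomogenize N)).toRingHom := by
    refine MvPolynomial.ringHom_ext (fun c => ?_) fun i => ?_
    · simp [centerAt, dehomogenize, translate, MvPolynomial.algebraMap_apply]
    · refine Fin.cases ?_ (fun j => ?_) i
      · simp [centerAt, dehomogenize, translate]
      · simp [centerAt, dehomogenize, translate]
  exact DFunLike.congr_fun this f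

theorem jointlyHomogeneous_centerAt (y : Fin N → L) {d : ℕ} {f : MvPolynomial (Fin (N + 1)) L}
    (hf : f.IsHomogeneous d) : JointlyHomogeneous d (centerAt y f) := by
  rw [f.as_sum, map_sum]
  refine JointlyHomogeneous.sum fun s hs => ?_
  have hsd : s.degree = d := by
    by_contra h
    exact mem_support_iff.mp hs (hf.coeff_eq_zero h)
  rw [centerAt, aeval_monomial, Finsupp.prod_fintype _ _ (by simp)]
  have h1 := (jointlyHomogeneous_C_C (σ := Fin N) (coeff s f)).mul
    (JointlyHomogeneous.prod (t := Finset.univ) (d := fun i => s i * 1)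
      (f := fun i => (Fin.cons (C Polynomial.X) (fun i => X i + C (Polynomial.C (y i)) *
        C Polynomial.X) : Fin (N + 1) → MvPolynomial (Fin N) (Polynomial L)) i ^ s i)
      fun i _ => JointlyHomogeneous.pow ?_ (s i))
  · simp only [mul_one, zero_add, ← Finsupp.degree_eq_sum, hsd] at h1
    exact h1
  · refine Fin.cases ?_ (fun j => ?_) i
    · exact jointlyHomogeneous_C_X
    · refine JointlyHomogeneous.add (jointlyHomogeneous_X j) ?_
      simpa using (jointlyHomogeneous_C_C (y j)).mul (jointlyHomogeneous_C_X (σ := Fin N))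

theorem dehomogenize_ne_zero {d : ℕ} {f : MvPolynomial (Fin (N + 1)) L} (hf : f.IsHomogeneous d)
    (h0 : f ≠ 0) : dehomogenize N f ≠ 0 := by
  intro h
  have h1 := map_centerAt 0 f
  rw [h, map_zero] at h1
  have h2 := (jointlyHomogeneous_centerAt 0 hf).eq_zero h1
  exact h0 (centerAt_injective 0 (h2.trans (map_zero _).symm))

theorem totalDegree_dehomogenize_le (f : MvPolynomial (Fin (N + 1)) L) :
    (dehomogenize N f).totalDegree ≤ f.totalDegree := by
  have : dehomogenize N f = restrictHead N 1 f := by simp [dehomogenize, restrictHead]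
  rw [this]
  exact totalDegree_restrictHead_le 1 f

theorem exists_isHomogeneous_dehomogenize_eq {d : ℕ} {φ : MvPolynomial (Fin N) L}
    (hφ : φ.totalDegree ≤ d) :
    ∃ f : MvPolynomial (Fin (N + 1)) L, f.IsHomogeneous d ∧ dehomogenize N f = φ := by
  refine ⟨∑ s ∈ φ.support, monomial (Finsupp.cons (d - s.degree) s) (coeff s φ), ?_, ?_⟩
  · refine IsHomogeneous.sum _ _ _ fun s hs => isHomogeneous_monomial _ ?_
    have h1 : s.degree ≤ d := (le_totalDegree hs).trans hφ
    rw [Finsupp.degree_eq_sum, Fin.sum_univ_succ]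
    simp only [Finsupp.cons_zero, Finsupp.cons_succ, ← Finsupp.degree_eq_sum]
    omega
  · conv_rhs => rw [φ.as_sum]
    rw [map_sum]
    refine Finset.sum_congr rfl fun s _ => ?_
    rw [dehomogenize, aeval_monomial, Finsupp.prod_fintype _ _ (by simp), Fin.prod_univ_succ,
      monomial_eq, Finsupp.prod_fintype _ _ (by simp)]
    simp [algebraMap_eq]

end Dehomogenization

/-! ### Ideals of points in affine coordinates -/

section PointIdeal

variable {L : Type*} [Field L] {N : ℕ}

/-- The point `p` has the affine coordinates `y`. -/
def HasAffineCoords (p : ℙ L (Fin (N + 1) → L)) (y : Fin N → L) : Prop :=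
  ∃ c : L, c ≠ 0 ∧ p.rep = c • (Fin.cons 1 y : Fin (N + 1) → L)

theorem hasAffineCoords_mk {v : Fin (N + 1) → L} (hv : v ≠ 0) (h0 : v 0 ≠ 0) :
    HasAffineCoords (Projectivization.mk L v hv) fun i => v i.succ / v 0 := by
  obtain ⟨c, hc⟩ := Projectivization.exists_smul_eq_mk_rep L v hv
  refine ⟨c * v 0, mul_ne_zero c.ne_zero h0, ?_⟩
  rw [← hc]
  funext i
  refine Fin.cases ?_ (fun j => ?_) i
  · simp [Units.smul_def]
  · simp [Units.smul_def]
    field_simp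

theorem HasAffineCoords.eval_rep_eq_zero_iff {p : ℙ L (Fin (N + 1) → L)} {y : Fin N → L}
    (hp : HasAffineCoords p y) {d : ℕ} {f : MvPolynomial (Fin (N + 1)) L}
    (hf : f.IsHomogeneous d) : eval p.rep f = 0 ↔ eval (Fin.cons 1 y) f = 0 := by
  obtain ⟨c, hc, h⟩ := hp
  have : eval p.rep f = c ^ d * eval (Fin.cons 1 y) f := by
    rw [h, eval_eq, eval_eq, Finset.mul_sum]
    refine Finset.sum_congr rfl fun s hs => ?_
    have hsd : s.degree = d := by
      by_contra h
      exact mem_support_iff.mp hs (hf.coeff_eq_zero h)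
    have : ∏ i ∈ s.support, (c • (Fin.cons 1 y : Fin (N + 1) → L)) i ^ s i =
        c ^ d * ∏ i ∈ s.support, (Fin.cons 1 y : Fin (N + 1) → L) i ^ s i := by
      simp only [Pi.smul_apply, smul_eq_mul, mul_pow, Finset.prod_mul_distrib]
      rw [Finset.prod_pow_eq_pow_sum, ← hsd]
      rfl
    rw [this]
    ring
  rw [this, mul_eq_zero, or_iff_right (pow_ne_zero _ hc)]

theorem coeff_zero_translate_dehomogenize (y : Fin N → L) (f : MvPolynomial (Fin (N + 1)) L) :
    coeff 0 (translate y (dehomogenize N f)) = eval (Fin.cons 1 y) f := by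
  have : (constantCoeff (σ := Fin N) (R := L)).comp
      ((translate y).comp (dehomogenize N)).toRingHom = eval (Fin.cons 1 y) := by
    refine MvPolynomial.ringHom_ext (fun c => ?_) fun i => ?_
    · simp [dehomogenize, translate]
    · refine Fin.cases ?_ (fun j => ?_) i
      · simp [dehomogenize, translate]
      · simp [dehomogenize, translate]
  exact DFunLike.congr_fun this f

/-- `centerAt y` and `uncenterAt y` carry the generators of each ideal into the other. Homogeneity
of `f` is not assumed, since primality and the primary property concern arbitrary elements. -/
theorem HasAffineCoords.mem_pointIdeal_pow_iff {p : ℙ L (Fin (N + 1) → L)} {y : Fin N → L}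
    (hp : HasAffineCoords p y) {a : ℕ} {f : MvPolynomial (Fin (N + 1)) L} :
    f ∈ pointIdeal p ^ a ↔ centerAt y f ∈ idealOfVars (Fin N) (Polynomial L) ^ a := by
  constructor
  · intro h
    have h1 : (pointIdeal p).map (centerAt y).toRingHom ≤ idealOfVars (Fin N) (Polynomial L) := by
      rw [pointIdeal, Ideal.map_span, Ideal.span_le]
      rintro _ ⟨g, ⟨⟨d, hg⟩, h0⟩, rfl⟩
      rw [hp.eval_rep_eq_zero_iff hg] at h0
      rw [SetLike.mem_coe, ← pow_one (idealOfVars (Fin N) (Polynomial L)),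
        mem_pow_idealOfVars_iff']
      intro s hs
      obtain rfl : s = 0 := by
        rw [← Finsupp.degree_eq_zero_iff]
        omega
      refine (jointlyHomogeneous_centerAt y hg).coeff_eq_zero ?_
      rw [map_centerAt, coeff_zero_translate_dehomogenize, h0]
    have h2 := Ideal.mem_map_of_mem (centerAt y).toRingHom h
    rw [Ideal.map_pow] at h2
    exact Ideal.pow_right_mono h1 a h2
  · intro h
    have h1 : (idealOfVars (Fin N) (Polynomial L)).map (uncenterAt y) ≤ pointIdeal p := by
      rw [Ideal.map_span, Ideal.span_le]
      rintro _ ⟨_, ⟨i, rfl⟩, rfl⟩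
      refine Ideal.subset_span ?_
      have hhom : (X i.succ - C (y i) * X 0 : MvPolynomial (Fin (N + 1)) L).IsHomogeneous 1 := by
        refine (isHomogeneous_X L i.succ).sub ?_
        simpa using (isHomogeneous_C (Fin (N + 1)) (y i)).mul (isHomogeneous_X L 0)
      have hX : uncenterAt y (X i) = X i.succ - C (y i) * X 0 := by simp [uncenterAt]
      rw [hX]
      refine ⟨⟨1, hhom⟩, ?_⟩
      rw [hp.eval_rep_eq_zero_iff hhom]
      simp
    have h2 := Ideal.mem_map_of_mem (uncenterAt y) h
    rw [Ideal.map_pow, uncenterAt_centerAt] at h2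
    exact Ideal.pow_right_mono h1 a h2

theorem HasAffineCoords.mem_pointIdeal_iff {p : ℙ L (Fin (N + 1) → L)} {y : Fin N → L}
    (hp : HasAffineCoords p y) {f : MvPolynomial (Fin (N + 1)) L} :
    f ∈ pointIdeal p ↔ coeff 0 (centerAt y f) = 0 := by
  rw [← pow_one (pointIdeal p), hp.mem_pointIdeal_pow_iff, mem_pow_idealOfVars_iff']
  simp [Finsupp.degree_eq_zero_iff]

theorem HasAffineCoords.mem_pointIdeal_pow_iff_of_isHomogeneous {p : ℙ L (Fin (N + 1) → L)}
    {y : Fin N → L} (hp : HasAffineCoords p y) {a d : ℕ} {f : MvPolynomial (Fin (N + 1)) L}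
    (hf : f.IsHomogeneous d) :
    f ∈ pointIdeal p ^ a ↔ translate y (dehomogenize N f) ∈ idealOfVars (Fin N) L ^ a := by
  rw [hp.mem_pointIdeal_pow_iff, (jointlyHomogeneous_centerAt y hf).mem_pow_idealOfVars_iff,
    map_centerAt]

theorem HasAffineCoords.mem_pow_of_mul_mem {p : ℙ L (Fin (N + 1) → L)} {y : Fin N → L}
    (hp : HasAffineCoords p y) {a : ℕ} {f g : MvPolynomial (Fin (N + 1)) L}
    (h : f * g ∈ pointIdeal p ^ a) (hf : f ∉ pointIdeal p) : g ∈ pointIdeal p ^ a := by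
  rw [hp.mem_pointIdeal_pow_iff] at h ⊢
  rw [hp.mem_pointIdeal_iff] at hf
  rw [map_mul] at h
  exact mem_pow_idealOfVars_of_mul_left h hf

theorem HasAffineCoords.isPrime {p : ℙ L (Fin (N + 1) → L)} {y : Fin N → L}
    (hp : HasAffineCoords p y) : (pointIdeal p).IsPrime := by
  refine Ideal.isPrime_iff.mpr ⟨fun h => ?_, fun {f g} h => or_iff_not_imp_left.mpr fun hf => ?_⟩
  · rw [Ideal.eq_top_iff_one, hp.mem_pointIdeal_iff] at h
    simp at h
  · rw [← pow_one (pointIdeal p)] at h ⊢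
    exact hp.mem_pow_of_mul_mem h hf

/-- The linear forms `X i.succ - y i * X 0` separate the two points. -/
theorem HasAffineCoords.not_le {p q : ℙ L (Fin (N + 1) → L)} {y z : Fin N → L}
    (hp : HasAffineCoords p y) (hq : HasAffineCoords q z) (h : y ≠ z) :
    ¬ pointIdeal p ≤ pointIdeal q := by
  intro hle
  refine h (funext fun i => ?_)
  have h1 : X i.succ - C (y i) * X 0 ∈ pointIdeal p := by
    rw [hp.mem_pointIdeal_iff]
    simp [centerAt, MvPolynomial.algebraMap_apply]
  have h2 := hle h1
  rw [hq.mem_pointIdeal_iff] at h2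
  have h3 := congrArg (Polynomial.eval 1) h2
  simp [centerAt, MvPolynomial.algebraMap_apply] at h3
  exact (sub_eq_zero.mp h3).symm

/-- The least degree of a form in an intersection of powers of ideals of points is the least degree
of an interpolant in affine coordinates. -/
theorem alpha_iInf_pow {ι : Type*} {p : ι → ℙ L (Fin (N + 1) → L)} {y : ι → Fin N → L}
    (hp : ∀ j, HasAffineCoords (p j) (y j)) (a : ι → ℕ) :
    alpha (⨅ j, pointIdeal (p j) ^ a j) = sInf {d | HasInterpolant y a d} := by
  rw [alpha]
  congr 1
  ext d
  constructor
  · rintro ⟨f, hf, h0, hd⟩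
    refine ⟨dehomogenize N f, dehomogenize_ne_zero hd h0,
      (totalDegree_dehomogenize_le f).trans hd.totalDegree_le, fun j => ?_⟩
    rw [← (hp j).mem_pointIdeal_pow_iff_of_isHomogeneous hd]
    exact (Submodule.mem_iInf _).mp hf j
  · rintro ⟨φ, h0, hd, hv⟩
    obtain ⟨f, hf, rfl⟩ := exists_isHomogeneous_dehomogenize_eq hd
    refine ⟨f, (Submodule.mem_iInf _).mpr fun j => ?_, ?_, hf⟩
    · rw [(hp j).mem_pointIdeal_pow_iff_of_isHomogeneous hf]
      exact hv j
    · rintro rfl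
      simp at h0

end PointIdeal

/-! ### Symbolic powers of fat point ideals -/

section SymbolicPower

/-- Symbolic powers of an intersection of powers of incomparable primes whose powers are primary. -/
theorem symbolicPower_iInf_pow {R : Type u} [CommRing R] {ι : Type*} [Finite ι] {P : ι → Ideal R}
    (hP : ∀ j, (P j).IsPrime)
    (hprim : ∀ j a x y, x * y ∈ P j ^ a → x ∉ P j → y ∈ P j ^ a)
    (hne : ∀ i j, i ≠ j → ¬ P i ≤ P j) (a : ι → ℕ) (k : ℕ) :
    symbolicPower (⨅ j, P j ^ a j) k = ⨅ j, P j ^ (k * a j) := by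
  classical
  cases nonempty_fintype ι
  -- The separator of `P j` has annihilator with radical `P j` in the quotient when `a j ≠ 0`, and
  -- its powers serve as denominators at `P j`.
  have hsep : ∀ j, ∃ t, t ∉ P j ∧ ∀ i, i ≠ j → t ∈ P i ^ a i := by
    intro j
    have h1 : ∀ i, ∃ t, t ∉ P j ∧ (i ≠ j → t ∈ P i) := by
      intro i
      by_cases hij : i = j
      · exact ⟨1, fun h => (hP j).ne_top ((Ideal.eq_top_iff_one _).mpr h), fun h => (h hij).elim⟩
      · obtain ⟨t, ht, ht'⟩ := SetLike.not_le_iff_exists.mp (hne i j hij)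
        exact ⟨t, ht', fun _ => ht⟩
    choose t ht ht' using h1
    refine ⟨∏ i, t i ^ a i, fun h => ?_, fun i hi => ?_⟩
    · obtain ⟨i, _, hi⟩ := (hP j).prod_mem_iff.mp h
      exact ht i ((hP j).mem_of_pow_mem _ hi)
    · exact Ideal.mem_of_dvd _ (Finset.dvd_prod_of_mem _ (Finset.mem_univ i))
        (Ideal.pow_mem_pow (ht' i hi) _)
  choose t ht ht' using hsep
  have hass : ∀ j, a j ≠ 0 → P j ∈ associatedPrimes R (R ⧸ ⨅ j, P j ^ a j) := by
    intro j hj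
    refine ⟨hP j, Ideal.Quotient.mk _ (t j), ?_⟩
    ext x
    simp only [Ideal.mem_radical_iff, Submodule.mem_colon_singleton, Submodule.mem_bot]
    have hmk : ∀ z : R, z • (Ideal.Quotient.mk (⨅ j, P j ^ a j) (t j)) = 0 ↔
        z * t j ∈ ⨅ j, P j ^ a j := by
      intro z
      rw [← Ideal.Quotient.eq_zero_iff_mem, map_mul]
      rfl
    simp only [hmk, Submodule.mem_iInf]
    constructor
    · intro hx
      refine ⟨a j, fun i => ?_⟩
      by_cases hij : i = j
      · subst hij
        exact Ideal.mul_mem_right _ _ (Ideal.pow_mem_pow hx _)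
      · exact Ideal.mul_mem_left _ _ (ht' j i hij)
    · rintro ⟨n, hn⟩
      have h1 := hprim j (a j) (t j) (x ^ n) (by rw [mul_comm]; exact hn j) (ht j)
      exact (hP j).mem_of_pow_mem _ (Ideal.pow_le_self hj h1)
  have hass' : ∀ Q ∈ associatedPrimes R (R ⧸ ⨅ j, P j ^ a j), ∃ j, Q = P j := by
    rintro Q ⟨hQ, z, hz⟩
    obtain ⟨x, rfl⟩ := Ideal.Quotient.mk_surjective z
    have hmem : ∀ r, r ∈ Q ↔ ∃ n, ∀ j, r ^ n * x ∈ P j ^ a j := by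
      intro r
      rw [hz, Ideal.mem_radical_iff]
      refine exists_congr fun n => ?_
      rw [Submodule.mem_colon_singleton, Submodule.mem_bot, ← Submodule.mem_iInf,
        ← Ideal.Quotient.eq_zero_iff_mem, map_mul]
      rfl
    -- Elements of all components that miss `x` multiply `x` into the whole intersection, so they
    -- lie in `Q`; the prime `Q` then contains one of these components.
    have hle : (⨅ j ∈ Finset.univ.filter fun j => x ∉ P j ^ a j, P j ^ a j) ≤ Q := by
      intro r hr
      rw [hmem]
      refine ⟨1, fun j => ?_⟩
      rw [pow_one]
      by_cases hx : x ∈ P j ^ a j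
      · exact Ideal.mul_mem_left _ _ hx
      · simp only [Submodule.mem_iInf] at hr
        exact Ideal.mul_mem_right _ _ (hr j (by simpa using hx))
    rw [← Finset.inf_eq_iInf] at hle
    obtain ⟨j, hj, hjQ⟩ := hQ.inf_le'.mp hle
    simp only [Finset.mem_filter, Finset.mem_univ, true_and] at hj
    refine ⟨j, le_antisymm (fun r hr => ?_) (hQ.le_of_pow_le hjQ)⟩
    obtain ⟨n, hn⟩ := (hmem r).mp hr
    by_contra hrj
    exact hj (hprim j (a j) (r ^ n) x (hn j) fun h => hrj ((hP j).mem_of_pow_mem _ h))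
  have hloc : ∀ (Q : Ideal R) (hQ : Q.IsPrime) (J : Ideal R) (f : R),
      f ∈ (J.map (algebraMap R (Localization.AtPrime Q))).comap
        (algebraMap R (Localization.AtPrime Q)) ↔ ∃ s ∉ Q, s * f ∈ J := by
    intro Q hQ J f
    rw [Ideal.mem_comap, IsLocalization.algebraMap_mem_map_algebraMap_iff Q.primeCompl]
    rfl
  ext f
  simp only [symbolicPower, Submodule.mem_iInf]
  constructor
  · intro h j
    -- A component with exponent `0` is the whole ring, and its prime need not be associated.
    by_cases hj : a j = 0
    · simp [hj]
    obtain ⟨s, hs, hsf⟩ := (hloc _ (hP j) _ f).mp (h ⟨P j, hass j hj⟩)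
    refine hprim j _ s f ?_ hs
    rw [mul_comm k, pow_mul]
    exact Ideal.pow_right_mono (iInf_le _ j) k hsf
  · rintro h ⟨Q, hQ⟩
    obtain ⟨j, rfl⟩ := hass' Q hQ
    refine (hloc _ (hP j) _ f).mpr ⟨t j ^ k, fun h' => ht j ((hP j).mem_of_pow_mem _ h'), ?_⟩
    have h1 : t j ^ k * f ∈ (Ideal.span {t j} * P j ^ a j) ^ k := by
      rw [mul_pow, ← pow_mul, mul_comm (a j)]
      exact Ideal.mul_mem_mul (Ideal.pow_mem_pow (Ideal.mem_span_singleton_self _) _) (h j)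
    refine Ideal.pow_right_mono ?_ k h1
    refine le_iInf fun i => ?_
    by_cases hij : i = j
    · subst hij
      exact Ideal.mul_le_right
    · refine Ideal.mul_le_left.trans ?_
      rw [Ideal.span_singleton_le_iff_mem]
      exact ht' j i hij

end SymbolicPower

/-! ### General points, existence of the limits, and the comparison -/

section General

variable {K : Type u} [Field K]

/-- Clearing denominators in a polynomial in the affine coordinates `v (i + 1) / v 0`. -/
theorem exists_aeval_eq_pow_mul_aeval {ι : Type*} [Fintype ι] {N : ℕ}
    (F : MvPolynomial (ι × Fin N) K) :
    ∃ (G : MvPolynomial (ι × Fin (N + 1)) K) (r : ℕ), ∀ (L : Type u) [Field L] [Algebra K L]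
      (v : ι → Fin (N + 1) → L), (∀ j, v j 0 ≠ 0) →
      aeval (fun p : ι × Fin (N + 1) => v p.1 p.2) G =
        (∏ j, v j 0) ^ r * aeval (fun p : ι × Fin N => v p.1 p.2.succ / v p.1 0) F := by
  classical
  induction F using MvPolynomial.induction_on with
  | C c => exact ⟨C c, 0, fun L _ _ v hv => by simp⟩
  | add p q hp hq =>
    obtain ⟨G, r, hG⟩ := hp
    obtain ⟨H, s, hH⟩ := hq
    refine ⟨G * (∏ j, X (j, 0)) ^ s + H * (∏ j, X (j, 0)) ^ r, r + s, fun L _ _ v hv => ?_⟩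
    simp only [map_add, map_mul, map_pow, map_prod, aeval_X, hG L v hv, hH L v hv]
    ring
  | mul_X p i hp =>
    obtain ⟨G, r, hG⟩ := hp
    refine ⟨G * X (i.1, i.2.succ) * ∏ j ∈ Finset.univ.erase i.1, X (j, 0), r + 1,
      fun L _ _ v hv => ?_⟩
    simp only [map_mul, map_prod, aeval_X, hG L v hv]
    rw [pow_succ, ← Finset.mul_prod_erase Finset.univ (fun j => v j 0) (Finset.mem_univ i.1)]
    field_simp [hv i.1]

/-- A property that holds for all points whose affine coordinates lie in a nonempty open set holds
for points in general position. -/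
theorem forGeneralPoints_of_affine {N n : ℕ}
    {P : ∀ (L : Type u) [Field L] [Algebra K L], (Fin n → ℙ L (Fin (N + 1) → L)) → Prop}
    {F : MvPolynomial (Fin n × Fin N) K} (hF : F ≠ 0)
    (h : ∀ (L : Type u) [Field L] [Algebra K L] (p : Fin n → ℙ L (Fin (N + 1) → L))
      (y : Fin n → Fin N → L), (∀ j, HasAffineCoords (p j) (y j)) →
      aeval (fun i : Fin n × Fin N => y i.1 i.2) F ≠ 0 → P L p) :
    ForGeneralPoints K N n P := by
  obtain ⟨G, r, hG⟩ := exists_aeval_eq_pow_mul_aeval F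
  -- The second factor forces all points into the chart `x₀ ≠ 0`. That `G ≠ 0` is tested at the
  -- points `(1 : generic)`, where the cleared denominators equal `1`.
  refine ⟨G * ∏ j, X (j, 0), mul_ne_zero (fun h0 => hF ?_) ?_, fun L _ _ v hv hne => ?_⟩
  · let ψ := algebraMap (MvPolynomial (Fin n × Fin N) K)
      (FractionRing (MvPolynomial (Fin n × Fin N) K))
    have h1 := hG (FractionRing (MvPolynomial (Fin n × Fin N) K))
      (fun j => Fin.cons 1 fun i => ψ (X (j, i))) (by simp)
    simp only [h0, map_zero, Fin.cons_zero, Fin.cons_succ, div_one, Finset.prod_const_one, one_pow,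
      one_mul] at h1
    have h2 : aeval (fun p : Fin n × Fin N => ψ (X (p.1, p.2))) F = ψ F :=
      ((MvPolynomial.aeval_algebraMap_apply _ _ _).trans (by simp [ψ]))
    rw [h2] at h1
    exact IsFractionRing.injective (MvPolynomial (Fin n × Fin N) K) _ (h1.symm.trans (map_zero _).symm)
  · exact Finset.prod_ne_zero_iff.mpr fun j _ => X_ne_zero _
  · rw [map_mul, map_prod] at hne
    have hv0 : ∀ j, v j 0 ≠ 0 := by
      intro j
      have := Finset.prod_ne_zero_iff.mp (right_ne_zero_of_mul hne) j (Finset.mem_univ j)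
      simpa using this
    refine h L _ (fun j i => v j i.succ / v j 0) (fun j => hasAffineCoords_mk (hv j) (hv0 j)) ?_
    have h1 := left_ne_zero_of_mul hne
    rw [hG L v hv0] at h1
    exact right_ne_zero_of_mul h1

/-- The least degree of a form with multiplicities `k * m j` at generic points of `ℙ^N`. -/
def genericAlpha (K : Type u) [Field K] (N : ℕ) {n : ℕ} (m : Fin n → ℤ) (k : ℕ) : ℕ :=
  sInf {d | HasInterpolant (genericPoints K (Fin n) (Fin N)) (fun j => k * (m j).toNat) d}

theorem hasInterpolant_genericAlpha (N : ℕ) [NeZero N] {n : ℕ} (m : Fin n → ℤ) (k : ℕ) :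
    HasInterpolant (genericPoints K (Fin n) (Fin N)) (fun j => k * (m j).toNat)
      (genericAlpha K N m k) :=
  Nat.sInf_mem (HasInterpolant.exists _ _)

/-- Characteristic zero enters only here, to supply the infinite fields for
`HasInterpolant.of_generic`. -/
theorem infinite_of_algebra_charZero (K : Type*) [Field K] [CharZero K] (L : Type*) [Field L]
    [Algebra K L] : Infinite L := by
  have := charZero_of_injective_algebraMap (algebraMap K L).injective
  infer_instance

theorem forGeneralPoints_alpha_eq [CharZero K] (N : ℕ) [NeZero N] {n : ℕ} (m : Fin n → ℤ) (k : ℕ) :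
    ForGeneralPoints K N n
      (fun _ _ _ p => alpha (symbolicPower (fatPointsIdeal p m) k) = genericAlpha K N m k) := by
  classical
  have hlow : ∀ d, ∃ F : MvPolynomial (Fin n × Fin N) K, F ≠ 0 ∧ (d < genericAlpha K N m k →
      ∀ (L : Type u) [Field L] [Algebra K L] (v : Fin n → Fin N → L),
        aeval (fun p : Fin n × Fin N => v p.1 p.2) F ≠ 0 →
          ¬ HasInterpolant v (fun j => k * (m j).toNat) d) := by
    intro d
    by_cases hd : d < genericAlpha K N m k
    · obtain ⟨F, hF, h⟩ := exists_forall_not_hasInterpolant (Nat.notMem_of_lt_sInf hd)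
      exact ⟨F, hF, fun _ => h⟩
    · exact ⟨1, one_ne_zero, fun h => (hd h).elim⟩
  choose F hF hlow using hlow
  -- Distinct first affine coordinates make the points distinct, hence their ideals incomparable.
  let D : MvPolynomial (Fin n × Fin N) K :=
    ∏ i, ∏ j ∈ Finset.univ.erase i, (X (i, 0) - X (j, 0))
  refine forGeneralPoints_of_affine (F := D * ∏ d ∈ Finset.range (genericAlpha K N m k), F d)
    (mul_ne_zero ?_ (Finset.prod_ne_zero_iff.mpr fun d _ => hF d)) fun L _ _ p y hp hne => ?_
  · refine Finset.prod_ne_zero_iff.mpr fun i _ => Finset.prod_ne_zero_iff.mpr fun j hj h => ?_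
    have := X_injective (sub_eq_zero.mp h)
    simp only [Prod.mk.injEq, and_true] at this
    exact Finset.ne_of_mem_erase hj this.symm
  · rw [map_mul, map_prod, map_prod] at hne
    have hdist : ∀ i j, i ≠ j → y i ≠ y j := by
      intro i j hij h
      have h1 := Finset.prod_ne_zero_iff.mp (left_ne_zero_of_mul hne) i (Finset.mem_univ i)
      rw [map_prod] at h1
      have h2 := Finset.prod_ne_zero_iff.mp h1 j (Finset.mem_erase.mpr ⟨hij.symm, Finset.mem_univ j⟩)
      simp [h] at h2
    have hno : ∀ d < genericAlpha K N m k, ¬ HasInterpolant y (fun j => k * (m j).toNat) d :=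
      fun d hd => hlow d hd L y (Finset.prod_ne_zero_iff.mp (right_ne_zero_of_mul hne) d
        (Finset.mem_range.mpr hd))
    have := infinite_of_algebra_charZero K L
    have hyes : HasInterpolant y (fun j => k * (m j).toNat) (genericAlpha K N m k) :=
      (hasInterpolant_genericAlpha N m k).of_generic y
    rw [fatPointsIdeal, symbolicPower_iInf_pow (fun j => (hp j).isPrime)
      (fun j a f g => (hp j).mem_pow_of_mul_mem)
      (fun i j hij => (hp i).not_le (hp j) (hdist i j hij)), alpha_iInf_pow hp]
    refine le_antisymm (Nat.sInf_le hyes) (le_csInf ⟨_, hyes⟩ fun d hd => ?_)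
    by_contra hlt
    exact hno d (not_le.mp hlt) hd

theorem genericAlpha_add_le (N : ℕ) [NeZero N] {n : ℕ} (m : Fin n → ℤ) (k l : ℕ) :
    genericAlpha K N m (k + l) ≤ genericAlpha K N m k + genericAlpha K N m l := by
  refine Nat.sInf_le ?_
  have := (hasInterpolant_genericAlpha (K := K) N m k).mul (hasInterpolant_genericAlpha N m l)
  simp only [Set.mem_ofPred_eq, add_mul]
  exact this

theorem exists_isGenericWaldschmidtConstant [CharZero K] (N : ℕ) [NeZero N] {n : ℕ}
    (m : Fin n → ℤ) : ∃ γ : ℝ, IsGenericWaldschmidtConstant K N m γ ∧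
      Filter.Tendsto (fun k : ℕ => (genericAlpha K N m k : ℝ) / k) Filter.atTop (nhds γ) := by
  have hsub : Subadditive fun k => (genericAlpha K N m k : ℝ) := fun k l => by
    dsimp only
    exact_mod_cast genericAlpha_add_le N m k l
  have hlim := hsub.tendsto_lim ⟨0, by
    rintro _ ⟨k, rfl⟩
    positivity⟩
  exact ⟨hsub.lim, ⟨_, fun k _ => forGeneralPoints_alpha_eq N m k, hlim⟩, hlim⟩

/-- Replacing `2 ^ N` general points of multiplicity `1` by one general point of multiplicity `2`
does not increase the least degree. -/
theorem genericAlpha_cons_two_le [CharZero K] {N : ℕ} [NeZero N] {n q : ℕ} (hq : q = 2 ^ N)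
    (m : Fin n → ℤ) (k : ℕ) :
    genericAlpha K N (Fin.cons 2 m : Fin (n + 1) → ℤ) k ≤
      genericAlpha K N (Fin.append (fun _ : Fin q => (1 : ℤ)) m) k := by
  let e : (Fin N → Bool) ≃ Fin q := Fintype.equivFinOfCardEq (by simp [hq])
  -- The function field of `n + 1` generic points; the cube collapses to the point `z 0`.
  let E := FractionRing (MvPolynomial (Fin (n + 1) × Fin N) K)
  let z : Fin (n + 1) → Fin N → E := fun j i => algebraMap _ E (genericPoints K _ _ j i)
  let v : Fin (q + n) → Fin N → Polynomial E := Fin.append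
    (fun b i => Polynomial.C (z 0 i) +
      Polynomial.X * Polynomial.C (cubeVertex E (e.symm b) i))
    (fun j i => Polynomial.C (z j.succ i))
  have := infinite_of_algebra_charZero K (FractionRing (Polynomial E))
  -- `HasInterpolant.of_generic` needs a field, so it is applied over the fraction field of `E[t]`;
  -- `h2` descends to `E[t]`, where `t = 0` makes sense.
  have h1 := (hasInterpolant_genericAlpha (K := K) N (Fin.append (fun _ : Fin q => (1 : ℤ)) m)
    k).of_generic fun j i => algebraMap _ (FractionRing (Polynomial E)) (v j i)
  have h2 := h1.of_isFractionRing.comp (Sum.elim (Fin.castAdd n ∘ e) (Fin.natAdd q))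
  have h3 : HasInterpolant (Sum.elim
      (fun (b : Fin N → Bool) i => Polynomial.C (z 0 i) +
        Polynomial.X * Polynomial.C (cubeVertex E b i))
      (fun j i => Polynomial.C (z (Fin.succ j) i)))
      (Sum.elim (fun _ => k) fun j => k * (m j).toNat)
      (genericAlpha K N (Fin.append (fun _ : Fin q => (1 : ℤ)) m) k) := by
    convert h2 using 1
    · funext j
      rcases j with b | j <;> simp [v]
    · funext j
      rcases j with b | j <;> simp
  have h4 := h3.collision.comp (Fin.cons (Sum.inl ()) Sum.inr : Fin (n + 1) → Unit ⊕ Fin n)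
  refine Nat.sInf_le (HasInterpolant.of_isFractionRing (F := E) ?_)
  convert h4 using 1
  · funext j
    refine Fin.cases ?_ (fun i => ?_) j <;> simp [z]
  · funext j
    refine Fin.cases ?_ (fun i => ?_) j
    · simp [mul_comm]
    · simp

end General

end

end FatPoints

theorem mainTheorem4 (K : Type u) [Field K] [CharZero K] (n : ℕ) (m : Fin n → ℤ) :
    ∃ γ₁ γ₂ : ℝ,
      FatPoints.IsGenericWaldschmidtConstant K 3 (Fin.append (fun _ : Fin 8 => (1 : ℤ)) m) γ₁ ∧
      FatPoints.IsGenericWaldschmidtConstant K 3 (Fin.cons (2 : ℤ) m : Fin (n + 1) → ℤ) γ₂ ∧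
      γ₂ ≤ γ₁ := by
  obtain ⟨γ₁, h₁, hl₁⟩ := FatPoints.exists_isGenericWaldschmidtConstant (K := K) 3
    (Fin.append (fun _ : Fin 8 => (1 : ℤ)) m)
  obtain ⟨γ₂, h₂, hl₂⟩ := FatPoints.exists_isGenericWaldschmidtConstant (K := K) 3
    (Fin.cons (2 : ℤ) m : Fin (n + 1) → ℤ)
  refine ⟨γ₁, γ₂, h₁, h₂, le_of_tendsto_of_tendsto' hl₂ hl₁ fun k => ?_⟩
  have := FatPoints.genericAlpha_cons_two_le (K := K) (N := 3) (q := 8) (by norm_num) m k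
  gcongr
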